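/- Let $\mathcal{Y}$ be a finite set, $\mathcal{P}(\mathcal{Y})$ the set of probability vectors on $\mathcal{Y}$, $\mathcal{X}$ an arbitrary non-empty set, and $W:\mathcal{X}\to\mathcal{P}(\mathcal{Y})$, $x\mapsto W_x$, a memoryless channel, so that for $x^n\in\mathcal{X}^n$ and $E\subseteq\mathcal{Y}^n$ one has $W^n(E|x^n)=\sum_{y^n\in E}\prod_{i=1}^n W_{x_i}(y_i)$. For $\lambda_1,\lambda_2>0$, an $(n,N,\lambda_1,\lambda_2)$ deterministic identification (DI) code is a family of pairs $(u_j,E_j)$, $j\in\{1,\dots,N\}$, with $u_j\in\mathcal{X}^n$ and $E_j\subseteq\mathcal{Y}^n$, such that $W^n(E_j|u_j)\ge 1-\lambda_1$ for all $j$ and $W^n(E_k|u_j)\le\lambda_2$ for all $j\ne k$. Let $N_{\mathrm{DI}}(n,\lambda_1,\lambda_2)\in\mathbb{N}\cup\{\infty\}$ be the supremum of all $N$ for which such a code exists, and define the optimistic superexponential DI capacity $$\dot C^{\mathrm{opt}}_{\mathrm{DI}}(W)=\inf_{\lambda_1,\lambda_2>0}\ \limsup_{n\to\infty}\frac{\log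 N_{\mathrm{DI}}(n,\lambda_1,\lambda_2)}{n\log n}.$$ Let $\sqrt{W(\mathcal{X})}=\{(\sqrt{W_x(y)})_{y\in\mathcal{Y}} : x\in\mathcal{X}\}\subset\mathbb{R}^{\mathcal{Y}}$ with the Euclidean metric, and let $\overline d_M(F)=\limsup_{\delta\to0^+}\frac{\log\Gamma_\delta(F)}{-\log\delta}$ denote the upper Minkowski dimension of a non-empty bounded set $F$, where $\Gamma_\delta(F)$ is the minimal number of closed balls of radius $\delta$ with centres in $F$ whose union contains $F$. Then, for all $\lambda_1,\lambda_2>0$ with $\lambda_1+\lambda_2<1$, $$\tfrac14\,\overline d_M\big(\sqrt{W(\mathcal{X})}\big)\ \le\ \dot C^{\mathrm{opt}}_{\mathrm{DI}}(W)\ \le\ \limsup_{n\to\infty}\frac{\log N_{\mathrm{DI}}(n,\lambda_1,\lambda_2)}{n\log n}\ \le\ \tfrac12\,\overline d_M\big(\sqrt{W(\mathcal{X})}\big).$$ -/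

import Mathlib

open Filter Topology
open scoped NNReal ENNReal

/-- A memoryless channel with input alphabet `X` and finite output alphabet `Y`: each input `x` is
mapped to a probability vector `W x` on `Y`. -/
abbrev Channel (X Y : Type*) [Fintype Y] := X → stdSimplex ℝ Y

namespace Channel

variable {X Y : Type*} [Fintype Y]

/-- The single-letter transition probability `W(y|x)`. -/
def prob (W : Channel X Y) (x : X) (y : Y) : ℝ := (W x).1 y

/-- The probability `Wⁿ(E|xⁿ) = ∑_{yⁿ ∈ E} ∏ᵢ W(yᵢ|xᵢ)` that the output of `n` uses of the channel
on the input word `u` lies in the set `E` of output words. -/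
def blockProb (W : Channel X Y) {n : ℕ} (u : Fin n → X) (E : Finset (Fin n → Y)) : ℝ :=
  ∑ y ∈ E, ∏ i, W.prob (u i) (y i)

/-- The family `(u j, E j)`, `j ∈ [N]`, of code words and decoding sets is an `(n, N, l₁, l₂)`
deterministic identification code for `W`: the error probability of the first kind is at most `l₁`
and the error probability of the second kind is at most `l₂`. -/
structure IsDICode (W : Channel X Y) (n N : ℕ) (l₁ l₂ : ℝ)
    (u : Fin N → Fin n → X) (E : Fin N → Finset (Fin n → Y)) : Prop where
  first_kind : ∀ j, 1 - l₁ ≤ W.blockProb (u j) (E j)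
  second_kind : ∀ j k, j ≠ k → W.blockProb (u j) (E k) ≤ l₂

/-- `N_DI(n, l₁, l₂)`: the maximal number of messages of an `(n, N, l₁, l₂)` deterministic
identification code (`⊤` if there are codes with arbitrarily many messages). -/
noncomputable def maxDISize (W : Channel X Y) (n : ℕ) (l₁ l₂ : ℝ) : ℕ∞ :=
  ⨆ (N : ℕ) (_ : ∃ u E, W.IsDICode n N l₁ l₂ u E), (N : ℕ∞)

/-- The slightly superexponential rate `log N_DI(n, l₁, l₂) / (n log n)`. It does not depend on the
base of the logarithm. -/
noncomputable def superexpRate (W : Channel X Y) (l₁ l₂ : ℝ) (n : ℕ) : EReal :=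
  ENNReal.log (W.maxDISize n l₁ l₂ : ℝ≥0∞) / ((n * Real.log n : ℝ) : EReal)

/-- The optimistic superexponential deterministic identification capacity: the infimum over
`l₁, l₂ > 0` of the limit superior of the rates as `n → ∞`. -/
noncomputable def optimisticDICapacity (W : Channel X Y) : EReal :=
  ⨅ (l₁ : ℝ) (_ : 0 < l₁) (l₂ : ℝ) (_ : 0 < l₂), limsup (W.superexpRate l₁ l₂) atTop

/-- The unit vector `√(W x)` of the entrywise square roots of `W x`, in the Euclidean space
`ℝ^Y`. -/
noncomputable def sqrtVec (W : Channel X Y) (x : X) : EuclideanSpace ℝ Y :=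
  WithLp.toLp 2 fun y => √(W.prob x y)

/-- The square root `√(W(X)) = {√(W x) : x ∈ X}` of the output set of the channel. -/
def sqrtOutputSet (W : Channel X Y) : Set (EuclideanSpace ℝ Y) := Set.range W.sqrtVec

end Channel

/-- The upper Minkowski dimension `limsup_{δ → 0+} log Γ_δ(F) / (-log δ)`, where `Γ_δ(F)` is the
minimal number of closed balls of radius `δ` with centres in `F` whose union contains `F`. -/
noncomputable def upperMinkowskiDim {E : Type*} [PseudoEMetricSpace E] (F : Set E) : EReal :=
  limsup (fun δ : ℝ≥0 =>
    ENNReal.log (Metric.coveringNumber δ F : ℝ≥0∞) / ((-Real.log δ : ℝ) : EReal)) (𝓝[>] 0)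

/-!
The single-letter geometry enters through the identity `‖√W(x) - √W(x')‖² = 2 (1 - BC(x, x'))`,
where the Bhattacharyya coefficient `BC` is multiplicative over product distributions. Hence
`sqDist u v = ∑ᵢ ‖√W(uᵢ) - √W(vᵢ)‖²` controls how well the outputs of two words `u`, `v` can be
told apart: it is at least the squared Hellinger distance of the two product distributions
(`sum_sq_sqrt_sub_sqrt_le`), and the coefficient of the product is at most `exp (-sqDist u v / 2)`
(`prod_bhattacharyya_le_exp`).

Converse. For `l₁ + l₂ < 1` the outputs of two code words have total variation distance bounded
below, so `sqDist` is bounded below. Cover `√W(X)` by balls of radius slightly below `n ^ (-1/2)`: two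
code words whose letters lie in the same balls would have a vanishing `sqDist`, so there are at most
`Γ_δ ^ n` messages (`IsDICode.le_card_pow_of_cover`), and `log Γ_δ / log n` has limit superior at most
half the dimension.

Direct part. Take a `δ`-separated set of `Γ_δ` letters and block length `n` slightly above
`δ ^ (-4)`. Among the words over these letters one retains a set with pairwise Hamming distance
above `t n` (`Finset.exists_subset_pairwise_not_card_le`, the Gilbert–Varshamov argument) and with
output entropies within `√n` of each other (`exists_subset_wordNegEntropy_close`, a pigeonhole
argument); on the scale `n log n` this costs only a fraction `t` of the rate, and `t` is arbitrarily
small. The decoding set of `u` is its entropy-typical set, which has large probability under `u` by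
Chebyshev's inequality. On the words typical for both `u` and `v` the likelihood ratio is at most `exp (O(√n))`, while the Bhattacharyya
coefficient is at most `exp (-t n δ² / 2)`, and `n δ²` outgrows `√n` exactly because
`δ ≫ n ^ (-1/4)`; this bounds the error of the second kind (`blockProb_typicalSet_le`). The rate so
obtained is `log Γ_δ / log n ≈ log Γ_δ / (-4 log δ)`. As `n` is a function of `δ`, the radii along
which the limit superior in the dimension is attained yield infinitely many good block lengths.
-/

namespace Channel

variable {X Y : Type*} [Fintype Y]

/-! ### Product distributions and the Hellinger distance -/

lemma prob_nonneg (W : Channel X Y) (x : X) (y : Y) : 0 ≤ W.prob x y := (W x).2.1 y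

lemma sum_prob (W : Channel X Y) (x : X) : ∑ y, W.prob x y = 1 := (W x).2.2

lemma prob_le_one (W : Channel X Y) (x : X) (y : Y) : W.prob x y ≤ 1 := by
  rw [← W.sum_prob x]
  exact Finset.single_le_sum (fun y _ => W.prob_nonneg x y) (Finset.mem_univ y)

/-- The probability of the output word `y` when the input word is `u`. -/
noncomputable def wordProb (W : Channel X Y) {n : ℕ} (u : Fin n → X) (y : Fin n → Y) : ℝ :=
  ∏ i, W.prob (u i) (y i)

lemma wordProb_nonneg (W : Channel X Y) {n : ℕ} (u : Fin n → X) (y : Fin n → Y) :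
    0 ≤ W.wordProb u y := Finset.prod_nonneg fun _ _ => W.prob_nonneg _ _

lemma blockProb_eq_sum_wordProb (W : Channel X Y) {n : ℕ} (u : Fin n → X)
    (E : Finset (Fin n → Y)) : W.blockProb u E = ∑ y ∈ E, W.wordProb u y := rfl

lemma sum_word_prod {n : ℕ} (f : Fin n → Y → ℝ) :
    ∑ y : Fin n → Y, ∏ i, f i (y i) = ∏ i, ∑ y, f i y := by
  classical
  rw [Finset.prod_univ_sum, Fintype.piFinset_univ]

lemma sum_wordProb (W : Channel X Y) {n : ℕ} (u : Fin n → X) :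
    ∑ y, W.wordProb u y = 1 := by
  simp only [wordProb, sum_word_prod fun i y => W.prob (u i) y, sum_prob, Finset.prod_const_one]

/-- The Bhattacharyya coefficient `∑ y, √(W(y|x) W(y|x'))` of two output distributions. -/
noncomputable def bhattacharyya (W : Channel X Y) (x x' : X) : ℝ :=
  ∑ y, √(W.prob x y) * √(W.prob x' y)

lemma bhattacharyya_nonneg (W : Channel X Y) (x x' : X) : 0 ≤ W.bhattacharyya x x' :=
  Finset.sum_nonneg fun _ _ => by positivity

lemma dist_sqrtVec_sq (W : Channel X Y) (x x' : X) :
    dist (W.sqrtVec x) (W.sqrtVec x') ^ 2 = 2 * (1 - W.bhattacharyya x x') := by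
  rw [EuclideanSpace.dist_sq_eq]
  have h (y : Y) : dist (W.sqrtVec x y) (W.sqrtVec x' y) ^ 2
      = W.prob x y + W.prob x' y - 2 * (√(W.prob x y) * √(W.prob x' y)) := by
    rw [Real.dist_eq, sq_abs]
    simp only [sqrtVec]
    linear_combination Real.sq_sqrt (W.prob_nonneg x y) + Real.sq_sqrt (W.prob_nonneg x' y)
  simp only [h, Finset.sum_sub_distrib, Finset.sum_add_distrib, sum_prob, bhattacharyya,
    ← Finset.mul_sum]
  ring

lemma bhattacharyya_eq (W : Channel X Y) (x x' : X) :
    W.bhattacharyya x x' = 1 - dist (W.sqrtVec x) (W.sqrtVec x') ^ 2 / 2 := by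
  linarith [W.dist_sqrtVec_sq x x']

/-- The Bhattacharyya coefficient is multiplicative over the letters of the input words. -/
lemma sum_sqrt_wordProb (W : Channel X Y) {n : ℕ} (u v : Fin n → X) :
    ∑ y, √(W.wordProb u y) * √(W.wordProb v y) = ∏ i, W.bhattacharyya (u i) (v i) := by
  simp only [bhattacharyya,
    ← sum_word_prod fun i y => √(W.prob (u i) y) * √(W.prob (v i) y), wordProb]
  refine Finset.sum_congr rfl fun y _ => ?_
  rw [Real.sqrt_prod _ fun i _ => W.prob_nonneg _ _, Real.sqrt_prod _ fun i _ => W.prob_nonneg _ _,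
    Finset.prod_mul_distrib]

/-- The squared Euclidean distance of the vectors of single-letter square roots. -/
noncomputable def sqDist (W : Channel X Y) {n : ℕ} (u v : Fin n → X) : ℝ :=
  ∑ i, dist (W.sqrtVec (u i)) (W.sqrtVec (v i)) ^ 2

lemma prod_bhattacharyya_le_exp (W : Channel X Y) {n : ℕ} (u v : Fin n → X) :
    ∏ i, W.bhattacharyya (u i) (v i) ≤ Real.exp (-(W.sqDist u v / 2)) := by
  rw [sqDist, Finset.sum_div, ← Finset.sum_neg_distrib, Real.exp_sum]
  refine Finset.prod_le_prod (fun i _ => W.bhattacharyya_nonneg _ _) fun i _ => ?_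
  rw [bhattacharyya_eq]
  linarith [Real.add_one_le_exp (-(dist (W.sqrtVec (u i)) (W.sqrtVec (v i)) ^ 2 / 2))]

lemma one_sub_sqDist_le_prod_bhattacharyya (W : Channel X Y) {n : ℕ} (u v : Fin n → X) :
    1 - W.sqDist u v / 2 ≤ ∏ i, W.bhattacharyya (u i) (v i) := by
  classical
  suffices H : ∀ s : Finset (Fin n), 1 - ∑ i ∈ s, (1 - W.bhattacharyya (u i) (v i)) ≤
      ∏ i ∈ s, W.bhattacharyya (u i) (v i) ∧ ∏ i ∈ s, W.bhattacharyya (u i) (v i) ≤ 1 by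
    convert (H Finset.univ).1 using 2
    rw [sqDist, Finset.sum_div]
    exact Finset.sum_congr rfl fun i _ => by rw [bhattacharyya_eq]; ring
  intro s
  induction s using Finset.induction_on with
  | empty => simp
  | insert i s hi ih =>
    rw [Finset.sum_insert hi, Finset.prod_insert hi]
    have h0 := W.bhattacharyya_nonneg (u i) (v i)
    have h1 : W.bhattacharyya (u i) (v i) ≤ 1 := by
      rw [bhattacharyya_eq]
      linarith [sq_nonneg (dist (W.sqrtVec (u i)) (W.sqrtVec (v i)))]
    have h2 : 0 ≤ ∏ i ∈ s, W.bhattacharyya (u i) (v i) :=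
      Finset.prod_nonneg fun i _ => W.bhattacharyya_nonneg _ _
    constructor <;> nlinarith [ih.1, ih.2]

/-- The squared Hellinger distance of product distributions is subadditive. -/
lemma sum_sq_sqrt_sub_sqrt_le (W : Channel X Y) {n : ℕ} (u v : Fin n → X) :
    ∑ y, (√(W.wordProb u y) - √(W.wordProb v y)) ^ 2 ≤ W.sqDist u v := by
  have h (y : Fin n → Y) : (√(W.wordProb u y) - √(W.wordProb v y)) ^ 2
      = W.wordProb u y + W.wordProb v y - 2 * (√(W.wordProb u y) * √(W.wordProb v y)) := by
    linear_combination Real.sq_sqrt (W.wordProb_nonneg u y) + Real.sq_sqrt (W.wordProb_nonneg v y)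
  simp only [h, Finset.sum_sub_distrib, Finset.sum_add_distrib, sum_wordProb, ← Finset.mul_sum,
    sum_sqrt_wordProb]
  linarith [W.one_sub_sqDist_le_prod_bhattacharyya u v]

/-- The total variation distance is at most twice the Hellinger distance. -/
lemma blockProb_sub_le (W : Channel X Y) {n : ℕ} (u v : Fin n → X) (E : Finset (Fin n → Y)) :
    W.blockProb u E - W.blockProb v E ≤ 2 * √(W.sqDist u v) := by
  have hA : ∑ y ∈ E, (√(W.wordProb u y) - √(W.wordProb v y)) ^ 2 ≤ W.sqDist u v :=
    (Finset.sum_le_univ_sum_of_nonneg fun _ => sq_nonneg _).trans (W.sum_sq_sqrt_sub_sqrt_le u v)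
  have hB : ∑ y ∈ E, (√(W.wordProb u y) + √(W.wordProb v y)) ^ 2 ≤ 4 := by
    refine (Finset.sum_le_univ_sum_of_nonneg fun _ => sq_nonneg _).trans ?_
    calc ∑ y, (√(W.wordProb u y) + √(W.wordProb v y)) ^ 2
        ≤ ∑ y, (2 * W.wordProb u y + 2 * W.wordProb v y) := by
          refine Finset.sum_le_sum fun y _ => ?_
          nlinarith [sq_nonneg (√(W.wordProb u y) - √(W.wordProb v y)),
            Real.sq_sqrt (W.wordProb_nonneg u y), Real.sq_sqrt (W.wordProb_nonneg v y)]
      _ = 4 := by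
          rw [Finset.sum_add_distrib, ← Finset.mul_sum, ← Finset.mul_sum, sum_wordProb,
            sum_wordProb]
          norm_num
  calc W.blockProb u E - W.blockProb v E
      = ∑ y ∈ E, (√(W.wordProb u y) - √(W.wordProb v y)) *
          (√(W.wordProb u y) + √(W.wordProb v y)) := by
        rw [blockProb_eq_sum_wordProb, blockProb_eq_sum_wordProb, ← Finset.sum_sub_distrib]
        refine Finset.sum_congr rfl fun y _ => ?_
        linear_combination -Real.sq_sqrt (W.wordProb_nonneg u y)
          + Real.sq_sqrt (W.wordProb_nonneg v y)
    _ ≤ √(∑ y ∈ E, (√(W.wordProb u y) - √(W.wordProb v y)) ^ 2) *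
          √(∑ y ∈ E, (√(W.wordProb u y) + √(W.wordProb v y)) ^ 2) :=
        Real.sum_mul_le_sqrt_mul_sqrt _ _ _
    _ ≤ √(W.sqDist u v) * √4 := by gcongr
    _ = 2 * √(W.sqDist u v) := by
        rw [show (4 : ℝ) = 2 ^ 2 by norm_num, Real.sqrt_sq (by norm_num)]
        ring

/-! ### Upper bound on the number of messages -/

/-- If the square roots of the output distributions are covered by `#C` balls of radius
`δ < (1 - l₁ - l₂) / (4 √n)`, then code words all of whose letters lie in the same balls have outputs
too close in total variation to be told apart; hence there are at most `#C ^ n` messages. -/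
lemma IsDICode.le_card_pow_of_cover {W : Channel X Y} {n N : ℕ} {l₁ l₂ : ℝ}
    {u : Fin N → Fin n → X} {E : Fin N → Finset (Fin n → Y)} (h : W.IsDICode n N l₁ l₂ u E)
    {δ : ℝ} (hδ : 0 ≤ δ) (hn : 4 * δ * √n < 1 - l₁ - l₂) {C : Finset (EuclideanSpace ℝ Y)}
    (hC : ∀ x, ∃ c ∈ C, dist (W.sqrtVec x) c ≤ δ) : N ≤ C.card ^ n := by
  choose c hcC hc using hC
  have hinj : Function.Injective
      (fun j (i : Fin n) => (⟨c (u j i), hcC _⟩ : C)) := by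
    intro j k hjk
    by_contra hne
    have hi (i : Fin n) : dist (W.sqrtVec (u j i)) (W.sqrtVec (u k i)) ≤ 2 * δ := by
      have h1 : c (u j i) = c (u k i) := congrArg Subtype.val (congrFun hjk i)
      have h2 := hc (u j i)
      rw [h1] at h2
      linarith [dist_triangle_right (W.sqrtVec (u j i)) (W.sqrtVec (u k i)) (c (u k i)),
        hc (u k i)]
    have hs : W.sqDist (u j) (u k) ≤ (2 * δ * √n) ^ 2 := by
      calc W.sqDist (u j) (u k) ≤ ∑ _i : Fin n, (2 * δ) ^ 2 := by
            refine Finset.sum_le_sum fun i _ => ?_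
            gcongr
            exact hi i
        _ = (2 * δ * √n) ^ 2 := by
            rw [mul_pow _ √(n : ℝ), Real.sq_sqrt (Nat.cast_nonneg n)]
            simp [mul_comm]
    have h3 := W.blockProb_sub_le (u j) (u k) (E j)
    have h4 : √(W.sqDist (u j) (u k)) ≤ 2 * δ * √n := Real.sqrt_le_iff.2 ⟨by positivity, hs⟩
    linarith [h.first_kind j, h.second_kind k j (Ne.symm hne)]
  simpa using Fintype.card_le_of_injective _ hinj

/-! ### Entropy-typical sets -/

/-- Under a product distribution the second moment of a sum of centred functions of the single
letters is the sum of their second moments. -/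
lemma sum_wordProb_mul_sq (W : Channel X Y) {n : ℕ} (u : Fin n → X) (g : Fin n → Y → ℝ)
    (hg : ∀ i, ∑ y, W.prob (u i) y * g i y = 0) :
    ∑ y, W.wordProb u y * (∑ i, g i (y i)) ^ 2 = ∑ i, ∑ y, W.prob (u i) y * g i y ^ 2 := by
  classical
  have key (i j : Fin n) : ∑ y : Fin n → Y, W.wordProb u y * (g i (y i) * g j (y j)) =
      if i = j then ∑ y, W.prob (u i) y * g i y ^ 2 else 0 := by
    have h1 (y : Fin n → Y) : W.wordProb u y * (g i (y i) * g j (y j)) =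
        ∏ k, (W.prob (u k) (y k) * ((if k = i then g i (y k) else 1) *
          (if k = j then g j (y k) else 1))) := by
      rw [Finset.prod_mul_distrib, Finset.prod_mul_distrib]
      simp [wordProb]
    simp only [h1]
    rw [sum_word_prod fun k y => W.prob (u k) y * ((if k = i then g i y else 1) *
          (if k = j then g j y else 1))]
    split_ifs with hij
    · subst hij
      rw [Finset.prod_eq_single i]
      · simp [sq]
      · intro k _ hk
        simp [hk, sum_prob]
      · simp
    · refine Finset.prod_eq_zero (Finset.mem_univ i) ?_
      simpa [hij] using hg i
  simp only [sq (∑ i, g i _), Finset.sum_mul_sum]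
  simp only [Finset.mul_sum]
  rw [Finset.sum_comm]
  refine Finset.sum_congr rfl fun i _ => ?_
  rw [Finset.sum_comm]
  simp [key]

/-- The negative entropy `∑ y, W(y|x) log W(y|x)` of an output distribution; outputs of
probability zero contribute nothing since `0 * Real.log 0 = 0`. -/
noncomputable def negEntropy (W : Channel X Y) (x : X) : ℝ :=
  ∑ y, W.prob x y * Real.log (W.prob x y)

/-- The variance of the log-probability of an output distribution is bounded by a constant that
depends on the output alphabet only. -/
lemma sum_prob_mul_sq_log_sub_le (W : Channel X Y) (x : X) :
    ∑ y, W.prob x y * (Real.log (W.prob x y) - W.negEntropy x) ^ 2 ≤ 4 * Fintype.card Y := by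
  -- The variance is the second moment minus the squared mean.
  have h1 : ∑ y, W.prob x y * (Real.log (W.prob x y) - W.negEntropy x) ^ 2
      = ∑ y, W.prob x y * Real.log (W.prob x y) ^ 2 - W.negEntropy x ^ 2 := by
    have h (y : Y) : W.prob x y * (Real.log (W.prob x y) - W.negEntropy x) ^ 2 =
        W.prob x y * Real.log (W.prob x y) ^ 2
        - 2 * W.negEntropy x * (W.prob x y * Real.log (W.prob x y))
        + W.negEntropy x ^ 2 * W.prob x y := by ring
    simp only [h, Finset.sum_add_distrib, Finset.sum_sub_distrib, ← Finset.mul_sum, sum_prob]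
    rw [← negEntropy]
    ring
  -- With `s = √p` this is `p (log p)² = 4 (s log s)²` and `|s log s| < 1`.
  have h2 (y : Y) : W.prob x y * Real.log (W.prob x y) ^ 2 ≤ 4 := by
    rcases (W.prob_nonneg x y).eq_or_lt with h | h
    · simp [← h]
    · have h3 := Real.abs_log_mul_self_lt (√(W.prob x y)) (Real.sqrt_pos.2 h)
        (Real.sqrt_le_one.2 (W.prob_le_one x y))
      rw [Real.log_sqrt h.le, ← sq_lt_one_iff_abs_lt_one] at h3
      nlinarith [Real.sq_sqrt h.le]
  rw [h1]
  have h4 := Finset.sum_le_sum fun y (_ : y ∈ Finset.univ) => h2 y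
  simp only [Finset.sum_const, Finset.card_univ, nsmul_eq_mul] at h4
  nlinarith [sq_nonneg (W.negEntropy x)]

lemma negEntropy_nonpos (W : Channel X Y) (x : X) : W.negEntropy x ≤ 0 :=
  Finset.sum_nonpos fun y _ => mul_nonpos_of_nonneg_of_nonpos (W.prob_nonneg x y)
    (Real.log_nonpos (W.prob_nonneg x y) (W.prob_le_one x y))

lemma neg_card_le_negEntropy (W : Channel X Y) (x : X) :
    -(Fintype.card Y : ℝ) ≤ W.negEntropy x := by
  have h (y : Y) : -1 ≤ W.prob x y * Real.log (W.prob x y) := by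
    rcases (W.prob_nonneg x y).eq_or_lt with h | h
    · simp [← h]
    · have h3 := (abs_lt.1 (Real.abs_log_mul_self_lt _ h (W.prob_le_one x y))).1
      linarith
  have h4 := Finset.sum_le_sum fun y (_ : y ∈ Finset.univ) => h y
  simpa [negEntropy] using h4

/-- The negative entropy of the output distribution of a word. -/
noncomputable def wordNegEntropy (W : Channel X Y) {n : ℕ} (u : Fin n → X) : ℝ :=
  ∑ i, W.negEntropy (u i)

open Classical in
/-- The entropy-typical output words of `u`: those of positive probability whose log-probability
differs from its mean by at most `K √n`. Positivity has to be demanded, as `Real.log 0 = 0`. -/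
noncomputable def typicalSet (W : Channel X Y) {n : ℕ} (K : ℝ) (u : Fin n → X) :
    Finset (Fin n → Y) :=
  {y | 0 < W.wordProb u y ∧ |Real.log (W.wordProb u y) - W.wordNegEntropy u| ≤ K * √n}

lemma mem_typicalSet {W : Channel X Y} {n : ℕ} {K : ℝ} {u : Fin n → X} {y : Fin n → Y} :
    y ∈ W.typicalSet K u ↔
      0 < W.wordProb u y ∧ |Real.log (W.wordProb u y) - W.wordNegEntropy u| ≤ K * √n := by
  simp [typicalSet]

/-- Chebyshev's inequality for the log-probability of the output word. -/
lemma sum_compl_typicalSet_le [DecidableEq Y] (W : Channel X Y) {n : ℕ} (hn : 0 < n) {K : ℝ}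
    (hK : 0 < K) (u : Fin n → X) :
    ∑ y ∈ (W.typicalSet K u)ᶜ, W.wordProb u y ≤ 4 * Fintype.card Y / K ^ 2 := by
  have hn' : (0 : ℝ) < n := Nat.cast_pos.2 hn
  have hsum := W.sum_wordProb_mul_sq u
    (fun i y => Real.log (W.prob (u i) y) - W.negEntropy (u i)) fun i => by
      simp only [mul_sub, Finset.sum_sub_distrib, ← Finset.sum_mul, sum_prob, negEntropy]
      ring
  have hvar : ∑ i : Fin n, ∑ y, W.prob (u i) y *
      (Real.log (W.prob (u i) y) - W.negEntropy (u i)) ^ 2 ≤ n * (4 * Fintype.card Y) := by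
    simpa using Finset.sum_le_sum fun i (_ : i ∈ (Finset.univ : Finset (Fin n))) =>
      W.sum_prob_mul_sq_log_sub_le (u i)
  rw [le_div_iff₀ (by positivity), ← mul_le_mul_iff_right₀ hn']
  refine le_trans ?_ (hsum.trans_le hvar)
  rw [Finset.sum_mul, Finset.mul_sum]
  refine le_trans (Finset.sum_le_sum fun y hy => ?_)
    (Finset.sum_le_univ_sum_of_nonneg fun y => mul_nonneg (W.wordProb_nonneg u y) (sq_nonneg _))
  rw [Finset.mem_compl, mem_typicalSet, not_and, not_le] at hy
  rcases (W.wordProb_nonneg u y).eq_or_lt with h | h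
  · simp [← h]
  · have hlog : Real.log (W.wordProb u y) - W.wordNegEntropy u =
        ∑ i, (Real.log (W.prob (u i) (y i)) - W.negEntropy (u i)) := by
      rw [Finset.sum_sub_distrib, wordProb, Real.log_prod, wordNegEntropy]
      exact fun i _ => Finset.prod_ne_zero_iff.1 h.ne' i (Finset.mem_univ i)
    have h2 := hy h
    rw [hlog] at h2
    have h3 : (K * √n) ^ 2 ≤
        (∑ i, (Real.log (W.prob (u i) (y i)) - W.negEntropy (u i))) ^ 2 := by
      rw [← sq_abs (∑ i, _)]
      gcongr
    rw [mul_pow, Real.sq_sqrt hn'.le] at h3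
    calc (n : ℝ) * (W.wordProb u y * K ^ 2) = W.wordProb u y * (K ^ 2 * n) := by ring
      _ ≤ _ := by gcongr

lemma one_sub_le_blockProb_typicalSet (W : Channel X Y) {n : ℕ} (hn : 0 < n) {K : ℝ}
    (hK : 0 < K) (u : Fin n → X) :
    1 - 4 * Fintype.card Y / K ^ 2 ≤ W.blockProb u (W.typicalSet K u) := by
  classical
  have h := Finset.sum_add_sum_compl (W.typicalSet K u) (W.wordProb u)
  rw [sum_wordProb] at h
  rw [blockProb_eq_sum_wordProb]
  linarith [W.sum_compl_typicalSet_le hn hK u]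

/-- If the outputs of `u` and `v` have entropies within `√n` of each other, then on the words typical
for both the likelihood ratio is at most `exp ((2 K + 1) √n)`, so that the probability of such words
is controlled by the Bhattacharyya coefficient. -/
lemma blockProb_typicalSet_le (W : Channel X Y) {n : ℕ} (hn : 0 < n) {K : ℝ}
    (hK : 0 < K) (u v : Fin n → X) (huv : |W.wordNegEntropy u - W.wordNegEntropy v| ≤ √n) :
    W.blockProb u (W.typicalSet K v) ≤ 4 * Fintype.card Y / K ^ 2 +
      Real.exp (((2 * K + 1) * √n - W.sqDist u v) / 2) := by
  classical
  rw [blockProb_eq_sum_wordProb,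
    ← Finset.sum_sdiff (Finset.inter_subset_left (s₁ := W.typicalSet K v) (s₂ := W.typicalSet K u))]
  refine add_le_add ((Finset.sum_le_sum_of_subset_of_nonneg ?_ fun y _ _ =>
    W.wordProb_nonneg u y).trans (W.sum_compl_typicalSet_le hn hK u)) ?_
  · intro y hy
    simp only [Finset.mem_sdiff, Finset.mem_inter, not_and] at hy
    exact Finset.mem_compl.2 (hy.2 hy.1)
  · have h1 : ∀ y ∈ W.typicalSet K v ∩ W.typicalSet K u, W.wordProb u y ≤
        Real.exp ((2 * K + 1) * √n / 2) * (√(W.wordProb u y) * √(W.wordProb v y)) := by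
      intro y hy
      rw [Finset.mem_inter, mem_typicalSet, mem_typicalSet] at hy
      obtain ⟨⟨hv, hv'⟩, hu, hu'⟩ := hy
      have h2 : W.wordProb u y ≤ Real.exp ((2 * K + 1) * √n) * W.wordProb v y := by
        rw [← Real.exp_log hu, ← Real.exp_log hv, ← Real.exp_add, Real.exp_le_exp]
        linarith [(abs_le.1 hv').1, (abs_le.1 hu').2, (abs_le.1 huv).2]
      calc W.wordProb u y = √(W.wordProb u y) * √(W.wordProb u y) :=
            (Real.mul_self_sqrt hu.le).symm
        _ ≤ √(W.wordProb u y) * √(Real.exp ((2 * K + 1) * √n) * W.wordProb v y) := by gcongr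
        _ = _ := by
            rw [Real.sqrt_mul (Real.exp_pos _).le, ← Real.exp_half]
            ring
    calc _ ≤ ∑ y ∈ W.typicalSet K v ∩ W.typicalSet K u,
          Real.exp ((2 * K + 1) * √n / 2) * (√(W.wordProb u y) * √(W.wordProb v y)) :=
          Finset.sum_le_sum h1
      _ ≤ ∑ y, Real.exp ((2 * K + 1) * √n / 2) * (√(W.wordProb u y) * √(W.wordProb v y)) :=
          Finset.sum_le_univ_sum_of_nonneg fun y => by positivity
      _ ≤ Real.exp ((2 * K + 1) * √n / 2) * Real.exp (-(W.sqDist u v / 2)) := by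
          rw [← Finset.mul_sum, sum_sqrt_wordProb]
          gcongr
          exact W.prod_bhattacharyya_le_exp u v
      _ = _ := by
          rw [← Real.exp_add]
          ring_nf

end Channel

/-! ### Construction of codes -/

/-- The Gilbert–Varshamov argument: a finite set in which every element is near to at most `b`
elements contains a subset of proportion at least `1 / b` whose elements are pairwise not near. -/
lemma Finset.exists_subset_pairwise_not_card_le {α : Type*} (A : Finset α) (near : α → α → Prop)
    [DecidableRel near] (hrefl : ∀ a, near a a) (hsymm : ∀ a b, near a b → near b a) (b : ℕ)
    (hb : ∀ a ∈ A, (A.filter (near a)).card ≤ b) :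
    ∃ C ⊆ A, (C : Set α).Pairwise (fun a a' => ¬ near a a') ∧ A.card ≤ C.card * b := by
  classical
  obtain ⟨C, hC, hmax⟩ := Finset.exists_max_image
    (A.powerset.filter fun C : Finset α => (C : Set α).Pairwise fun a a' => ¬ near a a') Finset.card
    ⟨∅, by simp⟩
  rw [Finset.mem_filter, Finset.mem_powerset] at hC
  refine ⟨C, hC.1, hC.2, ?_⟩
  have hcov : A ⊆ C.biUnion fun c => A.filter (near c) := by
    intro a ha
    by_contra hcon
    simp only [Finset.mem_biUnion, Finset.mem_filter, not_exists, not_and] at hcon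
    have haC : a ∉ C := fun h => hcon a h ha (hrefl a)
    have := hmax (insert a C) (by
      rw [Finset.mem_filter, Finset.mem_powerset]
      refine ⟨Finset.insert_subset ha hC.1, ?_⟩
      rw [Finset.coe_insert, Set.pairwise_insert]
      exact ⟨hC.2, fun c hc _ => ⟨fun h => hcon c hc ha (hsymm _ _ h), hcon c hc ha⟩⟩)
    rw [Finset.card_insert_of_notMem haC] at this
    omega
  exact (Finset.card_le_card hcov).trans
    (Finset.card_biUnion_le_card_mul _ _ _ fun c hc => hb c (hC.1 hc))

open Classical in
/-- A Hamming ball of radius `k` in `Sⁿ` has at most `2ⁿ (#S)ᵏ` elements. -/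
lemma card_filter_hammingDist_le {X : Type*} (S : Finset X) (hS : S.Nonempty) {n : ℕ}
    (u : Fin n → X) (k : ℕ) :
    ((Fintype.piFinset fun _ : Fin n => S).filter fun v => hammingDist u v ≤ k).card
      ≤ 2 ^ n * S.card ^ k := by
  -- A word of the ball is determined by the set `D` of deviating positions and its letters there.
  have hsub : ((Fintype.piFinset fun _ : Fin n => S).filter fun v => hammingDist u v ≤ k) ⊆
      ((Finset.univ : Finset (Finset (Fin n))).filter fun D => D.card ≤ k).biUnion fun D =>
        Fintype.piFinset fun i => if i ∈ D then S else {u i} := by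
    intro v hv
    rw [Finset.mem_filter, Fintype.mem_piFinset] at hv
    rw [Finset.mem_biUnion]
    refine ⟨Finset.univ.filter fun i => u i ≠ v i, by simpa [hammingDist] using hv.2, ?_⟩
    rw [Fintype.mem_piFinset]
    intro i
    by_cases hi : u i = v i
    · simp [hi]
    · simpa [hi] using hv.1 i
  refine (Finset.card_le_card hsub).trans
    ((Finset.card_biUnion_le_card_mul _ _ (S.card ^ k) fun D hD => ?_).trans ?_)
  · rw [Fintype.card_piFinset]
    have h : ∀ i, (if i ∈ D then S else {u i}).card = if i ∈ D then S.card else 1 := by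
      intro i
      split_ifs <;> simp
    simp only [h, Finset.prod_ite_mem, Finset.univ_inter, Finset.prod_const]
    exact Nat.pow_le_pow_right hS.card_pos (Finset.mem_filter.1 hD).2
  · gcongr
    refine (Finset.card_filter_le _ _).trans ?_
    simp

namespace Channel

variable {X Y : Type*} [Fintype Y]

/-- Among the words over a finite set of input letters, the entropies of the outputs of at least one
in every `#Y · n + 1` lie in a common interval of length `√n`. -/
lemma exists_subset_wordNegEntropy_close (W : Channel X Y) {n : ℕ} (hn : 0 < n)
    (A : Finset (Fin n → X)) :
    ∃ B ⊆ A, (∀ u ∈ B, ∀ v ∈ B, |W.wordNegEntropy u - W.wordNegEntropy v| ≤ √n) ∧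
      (A.card : ℝ) ≤ B.card * (Fintype.card Y * n + 1) := by
  classical
  have hs : 0 < √(n : ℝ) := Real.sqrt_pos.2 (Nat.cast_pos.2 hn)
  have hs1 : 1 ≤ √(n : ℝ) := Real.one_le_sqrt.2 (Nat.one_le_cast.2 hn)
  set bin : (Fin n → X) → ℕ := fun u => ⌊-W.wordNegEntropy u / √n⌋₊ with hbin
  have h0 (u : Fin n → X) : 0 ≤ -W.wordNegEntropy u / √n := by
    refine div_nonneg (neg_nonneg.2 ?_) hs.le
    exact Finset.sum_nonpos fun i _ => W.negEntropy_nonpos _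
  have hmaps : ∀ u ∈ A, bin u ∈ Finset.range (Fintype.card Y * n + 1) := by
    intro u _
    rw [Finset.mem_range, Nat.lt_succ_iff]
    refine Nat.floor_le_of_le ((div_le_self ?_ hs1).trans ?_)
    · have := h0 u
      rwa [le_div_iff₀ hs, zero_mul] at this
    · have h := Finset.sum_le_sum fun i (_ : i ∈ (Finset.univ : Finset (Fin n))) =>
        W.neg_card_le_negEntropy (u i)
      simp only [Finset.sum_const, Finset.card_univ, Fintype.card_fin, nsmul_eq_mul] at h
      rw [← wordNegEntropy] at h
      push_cast
      linarith
  obtain ⟨k, -, hk⟩ := Finset.exists_le_card_fiber_of_nsmul_le_card_of_maps_to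
    (M := ℝ) hmaps ⟨0, by simp⟩ (b := A.card / (Fintype.card Y * n + 1)) (by
      rw [Finset.card_range, nsmul_eq_mul]
      push_cast
      rw [mul_div_cancel₀]
      positivity)
  refine ⟨_, Finset.filter_subset (fun u => bin u = k) A, fun u hu v hv => ?_, ?_⟩
  · have hfl (w : Fin n → X) (hw : bin w = k) :
        k * √n ≤ -W.wordNegEntropy w ∧ -W.wordNegEntropy w < (k + 1) * √n := by
      rw [← le_div_iff₀ hs, ← div_lt_iff₀ hs]
      exact (Nat.floor_eq_iff (h0 w)).1 hw
    have h1 := hfl u (Finset.mem_filter.1 hu).2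
    have h2 := hfl v (Finset.mem_filter.1 hv).2
    rw [abs_le]
    constructor <;> linarith
  · exact (div_le_iff₀ (by positivity)).1 hk

/-- Code words of large mutual Hamming distance over a `δ`-separated set of letters, with outputs of
nearly equal entropies, form an identification code when decoded by their typical sets. The three
factors by which its size falls short of `(#S) ^ n` come from the Hamming balls and from the choice
of an entropy interval. -/
lemma exists_isDICode (W : Channel X Y) {n : ℕ} (hn : 0 < n) {K t δ l₁ l₂ : ℝ} (hK : 0 < K)
    (hδ : 0 < δ) {S : Finset X} (hS : S.Nonempty)
    (hsep : ∀ x ∈ S, ∀ x' ∈ S, x ≠ x' → δ ≤ dist (W.sqrtVec x) (W.sqrtVec x'))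
    (h₁ : 4 * Fintype.card Y / K ^ 2 ≤ l₁) (h₂ : 4 * Fintype.card Y / K ^ 2 ≤ l₂ / 2)
    (h₃ : Real.exp (((2 * K + 1) * √n - t * n * δ ^ 2) / 2) ≤ l₂ / 2) :
    ∃ (N : ℕ) (u : Fin N → Fin n → X) (E : Fin N → Finset (Fin n → Y)),
      W.IsDICode n N l₁ l₂ u E ∧
      (S.card : ℝ) ^ n ≤
        N * (2 ^ n * S.card ^ ⌊t * n⌋₊) * (Fintype.card Y * n + 1) := by
  classical
  obtain ⟨B, hBA, hB, hBcard⟩ :=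
    W.exists_subset_wordNegEntropy_close hn (Fintype.piFinset fun _ : Fin n => S)
  obtain ⟨C, hCB, hC, hCcard⟩ := B.exists_subset_pairwise_not_card_le
    (fun u v => hammingDist u v ≤ ⌊t * n⌋₊) (fun u => by simp)
    (fun u v h => by rwa [hammingDist_comm]) (2 ^ n * S.card ^ ⌊t * n⌋₊)
    (fun u _ => (Finset.card_le_card (Finset.filter_subset_filter _ hBA)).trans
      (card_filter_hammingDist_le S hS u _))
  have hmem (j : Fin C.card) : (C.equivFin.symm j).1 ∈ C := (C.equivFin.symm j).2
  refine ⟨C.card, fun j => (C.equivFin.symm j).1, fun j => W.typicalSet K (C.equivFin.symm j).1,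
    ⟨fun j => ?_, fun j k hjk => ?_⟩, ?_⟩
  · linarith [W.one_sub_le_blockProb_typicalSet hn hK (C.equivFin.symm j).1]
  · set u : Fin n → X := (C.equivFin.symm j).1 with hu
    set v : Fin n → X := (C.equivFin.symm k).1 with hv
    have huv : u ≠ v := fun h => hjk (C.equivFin.symm.injective (Subtype.ext h))
    have hham : t * n ≤ hammingDist u v :=
      (Nat.lt_of_floor_lt (not_le.1 (hC (hmem j) (hmem k) huv))).le
    have hdist : t * n * δ ^ 2 ≤ W.sqDist u v := by
      calc t * n * δ ^ 2 ≤ hammingDist u v * δ ^ 2 := by gcongr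
        _ = ∑ i with u i ≠ v i, δ ^ 2 := by
            rw [Finset.sum_const, nsmul_eq_mul, hammingDist]
        _ ≤ ∑ i with u i ≠ v i, dist (W.sqrtVec (u i)) (W.sqrtVec (v i)) ^ 2 := by
            refine Finset.sum_le_sum fun i hi => ?_
            gcongr
            exact hsep _ (Fintype.mem_piFinset.1 (hBA (hCB (hmem j))) i) _
              (Fintype.mem_piFinset.1 (hBA (hCB (hmem k))) i) (Finset.mem_filter.1 hi).2
        _ ≤ W.sqDist u v := Finset.sum_le_univ_sum_of_nonneg fun i => sq_nonneg _
    have h4 := W.blockProb_typicalSet_le hn hK u v (hB u (hCB (hmem j)) v (hCB (hmem k)))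
    have h5 : Real.exp (((2 * K + 1) * √n - W.sqDist u v) / 2) ≤ l₂ / 2 := by
      refine le_trans ?_ h₃
      gcongr
    linarith
  · have h6 : (B.card : ℝ) ≤ C.card * (2 ^ n * S.card ^ ⌊t * n⌋₊) := by exact_mod_cast hCcard
    rw [Fintype.card_piFinset] at hBcard
    simp only [Finset.prod_const, Finset.card_univ, Fintype.card_fin, Nat.cast_pow] at hBcard
    exact hBcard.trans (by gcongr)

/-- A finite separated set of input letters as large as the covering number. The covering
number may be infinite here, which is why `m` is only required to be a lower bound. -/
lemma exists_separated_card_eq (W : Channel X Y) {δ : ℝ≥0} {m : ℕ}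
    (hm : (m : ℕ∞) ≤ Metric.coveringNumber δ W.sqrtOutputSet) :
    ∃ S : Finset X, S.card = m ∧
      ∀ x ∈ S, ∀ x' ∈ S, x ≠ x' → (δ : ℝ) ≤ dist (W.sqrtVec x) (W.sqrtVec x') := by
  classical
  rcases Nat.eq_zero_or_pos m with rfl | hm0
  · exact ⟨∅, by simp⟩
  have h1 : ((m - 1 : ℕ) : ℕ∞) < Metric.packingNumber δ W.sqrtOutputSet :=
    lt_of_lt_of_le (Nat.cast_lt.2 (by omega))
      (hm.trans (Metric.coveringNumber_le_packingNumber _ _))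
  simp only [Metric.packingNumber, lt_iSup_iff] at h1
  obtain ⟨C, hCF, hsep, hC⟩ := h1
  have h2 : (m : ℕ∞) ≤ C.encard := by
    have := Order.add_one_le_of_lt hC
    rwa [← Nat.cast_succ, Nat.succ_eq_add_one, Nat.sub_add_cancel hm0] at this
  obtain ⟨D, hDC, hD⟩ := Set.exists_subset_encard_eq h2
  have hDfin : D.Finite := Set.finite_of_encard_eq_coe hD
  have hDF : ∀ c ∈ D, ∃ x, W.sqrtVec x = c := fun c hc => hCF (hDC hc)
  choose g hg using hDF
  have hinj : Function.Injective fun c : D => g c c.2 := by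
    intro c d hcd
    have : W.sqrtVec (g c c.2) = W.sqrtVec (g d d.2) := congrArg _ hcd
    rw [hg, hg] at this
    exact Subtype.ext this
  have := hDfin.fintype
  refine ⟨Finset.univ.map ⟨_, hinj⟩, ?_, ?_⟩
  · rw [Finset.card_map, Finset.card_univ, ← Set.toFinset_card]
    rw [Set.encard_eq_coe_toFinset_card] at hD
    exact_mod_cast hD
  · simp only [Finset.mem_map, Finset.mem_univ, true_and, Function.Embedding.coeFn_mk,
      forall_exists_index, forall_apply_eq_imp_iff]
    intro c d hcd
    have hne : (c : EuclideanSpace ℝ Y) ≠ d := fun h => hcd (by rw [Subtype.ext h])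
    have h3 : (δ : ℝ≥0∞) < edist (c : EuclideanSpace ℝ Y) d := hsep (hDC c.2) (hDC d.2) hne
    rw [hg, hg]
    rw [edist_nndist, ENNReal.coe_lt_coe] at h3
    exact_mod_cast h3.le

end Channel

/-! ### Asymptotics of the rates -/

lemma ENNReal.log_natCast {N : ℕ} (hN : 0 < N) : ENNReal.log (N : ℝ≥0∞) = (Real.log N : EReal) := by
  rw [ENNReal.log_pos_real (by exact_mod_cast hN.ne') (ENNReal.natCast_ne_top N)]
  simp

lemma tendsto_neg_log_nnreal_nhdsGT_zero :
    Tendsto (fun δ : ℝ≥0 => -Real.log δ) (𝓝[>] 0) atTop := by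
  have h : Tendsto (fun δ : ℝ≥0 => (δ : ℝ)) (𝓝[>] 0) (𝓝[>] 0) := by
    refine tendsto_nhdsWithin_iff.2 ⟨?_, ?_⟩
    · exact (NNReal.continuous_coe.tendsto' 0 0 rfl).mono_left nhdsWithin_le_nhds
    · filter_upwards [self_mem_nhdsWithin] with δ hδ
      exact NNReal.coe_pos.2 hδ
  exact tendsto_neg_atBot_atTop.comp (Real.tendsto_log_nhdsGT_zero.comp h)

namespace Channel

variable {X Y : Type*} [Fintype Y]

lemma natCast_mul_log_pos {n : ℕ} (hn : 2 ≤ n) : 0 < n * Real.log n := by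
  have h : (1 : ℝ) < n := by exact_mod_cast hn
  exact mul_pos (by linarith) (Real.log_pos h)

lemma le_superexpRate {W : Channel X Y} {l₁ l₂ : ℝ} {n N : ℕ} (hn : 2 ≤ n) (hN : 0 < N)
    {u : Fin N → Fin n → X} {E : Fin N → Finset (Fin n → Y)} (h : W.IsDICode n N l₁ l₂ u E)
    {a : ℝ} (ha : a * (n * Real.log n) ≤ Real.log N) : (a : EReal) ≤ W.superexpRate l₁ l₂ n := by
  rw [superexpRate, EReal.le_div_iff_mul_le (by exact_mod_cast natCast_mul_log_pos hn)
    (EReal.coe_ne_top _), ← EReal.coe_mul]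
  refine (EReal.coe_le_coe ha).trans ?_
  rw [← ENNReal.log_natCast hN, ENNReal.log_le_log_iff]
  have : (N : ℕ∞) ≤ W.maxDISize n l₁ l₂ := le_iSup₂_of_le N ⟨u, E, h⟩ le_rfl
  exact_mod_cast this

lemma superexpRate_le {W : Channel X Y} {l₁ l₂ : ℝ} {n M : ℕ} (hn : 2 ≤ n) (hM : 0 < M)
    (h : ∀ N (u : Fin N → Fin n → X) (E : Fin N → Finset (Fin n → Y)),
      W.IsDICode n N l₁ l₂ u E → N ≤ M)
    {b : ℝ} (hb : Real.log M ≤ b * (n * Real.log n)) : W.superexpRate l₁ l₂ n ≤ b := by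
  rw [superexpRate, EReal.div_le_iff_le_mul (by exact_mod_cast natCast_mul_log_pos hn)
    (EReal.coe_ne_top _), ← EReal.coe_mul, mul_comm]
  refine le_trans ?_ (EReal.coe_le_coe hb)
  rw [← ENNReal.log_natCast hM, ENNReal.log_le_log_iff]
  have : W.maxDISize n l₁ l₂ ≤ (M : ℕ∞) :=
    iSup₂_le fun N ⟨u, E, hN⟩ => Nat.cast_le.2 (h N u E hN)
  exact_mod_cast this

/-- A code with a single message, decoded by the full output space, always exists. -/
lemma superexpRate_nonneg [Nonempty X] (W : Channel X Y) {l₁ l₂ : ℝ} (hl₁ : 0 < l₁) {n : ℕ}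
    (hn : 2 ≤ n) : 0 ≤ W.superexpRate l₁ l₂ n := by
  have x : X := Classical.arbitrary X
  refine le_superexpRate (N := 1) hn one_pos (u := fun _ _ => x) (E := fun _ => Finset.univ)
    ⟨fun j => ?_, fun j k hjk => absurd (Subsingleton.elim j k) hjk⟩ (a := 0) (by simp)
  rw [blockProb_eq_sum_wordProb, sum_wordProb]
  linarith

lemma coveringNumber_sqrtOutputSet_ne_zero [Nonempty X] (W : Channel X Y) (δ : ℝ≥0) :
    Metric.coveringNumber δ W.sqrtOutputSet ≠ 0 := by
  rw [Ne, Metric.coveringNumber_eq_zero]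
  exact (Set.range_nonempty _).ne_empty

/-- The converse: the covering radius is `δ = n ^ (-(1/2 + s))` with a small `s > 0`, which makes
`δ √n` tend to zero while `-log δ` stays close to `(log n) / 2`. -/
lemma limsup_superexpRate_le [Nonempty X] (W : Channel X Y) {l₁ l₂ : ℝ} (hl : l₁ + l₂ < 1) :
    limsup (W.superexpRate l₁ l₂) atTop ≤
      ((1 / 2 : ℝ) : EReal) * upperMinkowskiDim W.sqrtOutputSet := by
  rw [← EReal.le_of_forall_lt_iff_le]
  intro b hb
  have hd : upperMinkowskiDim W.sqrtOutputSet < ((2 * b : ℝ) : EReal) := by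
    by_contra! hcon
    refine hb.not_ge ?_
    calc (b : EReal) = ((1 / 2 : ℝ) : EReal) * ((2 * b : ℝ) : EReal) := by
          rw [← EReal.coe_mul]; congr 1; ring
      _ ≤ _ := mul_le_mul_of_nonneg_left hcon (by exact_mod_cast (by norm_num : (0 : ℝ) ≤ 1 / 2))
  obtain ⟨c, hdc, hcb⟩ := EReal.lt_iff_exists_real_btwn.1 hd
  have hcb : c < 2 * b := by exact_mod_cast hcb
  -- The choice of `s` allows for `c` of either sign.
  obtain ⟨s, hs, hsb⟩ : ∃ s : ℝ, 0 < s ∧ c * (1 / 2 + s) ≤ b := by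
    refine ⟨(b - c / 2) / (|c| + 1), by have := abs_nonneg c; apply div_pos <;> linarith, ?_⟩
    have h1 : c * ((b - c / 2) / (|c| + 1)) ≤ b - c / 2 := by
      rw [← mul_div_assoc, div_le_iff₀ (by positivity)]
      nlinarith [le_abs_self c]
    linarith
  have hlim : Tendsto (fun n : ℕ => (n : ℝ≥0) ^ (-(1 / 2 + s))) atTop (𝓝[>] 0) := by
    refine tendsto_nhdsWithin_iff.2 ⟨?_, ?_⟩
    · rw [← NNReal.tendsto_coe]
      refine ((tendsto_rpow_neg_atTop (by linarith : 0 < 1 / 2 + s)).comp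
        tendsto_natCast_atTop_atTop).congr fun n => ?_
      rw [Function.comp_apply, NNReal.coe_rpow, NNReal.coe_natCast]
    · filter_upwards [eventually_gt_atTop 0] with n hn
      exact NNReal.rpow_pos (by exact_mod_cast hn)
  have hsmall : ∀ᶠ n : ℕ in atTop, 4 * (n : ℝ) ^ (-s) < 1 - l₁ - l₂ := by
    have h := ((tendsto_rpow_neg_atTop hs).comp tendsto_natCast_atTop_atTop).const_mul (4 : ℝ)
    exact h.eventually_lt_const (by linarith)
  have hcov := hlim.eventually (eventually_lt_of_limsup_lt hdc)
  refine limsup_le_of_le (by isBoundedDefault) ?_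
  filter_upwards [hcov, hsmall, eventually_ge_atTop 2] with n hcov hsmall hn
  have hn0 : (0 : ℝ) < n := by positivity
  have hlogn : 0 < Real.log n := Real.log_pos (by exact_mod_cast hn)
  set δ : ℝ≥0 := (n : ℝ≥0) ^ (-(1 / 2 + s)) with hδ
  have hδr : (δ : ℝ) = (n : ℝ) ^ (-(1 / 2 + s)) := by simp [hδ]
  have hL : -Real.log δ = (1 / 2 + s) * Real.log n := by
    rw [hδr, Real.log_rpow hn0]; ring
  have hLpos : 0 < (1 / 2 + s) * Real.log n := by positivity
  rw [hL, EReal.div_lt_iff (by exact_mod_cast hLpos) (EReal.coe_ne_top _), ← EReal.coe_mul] at hcov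
  have htop : Metric.coveringNumber δ W.sqrtOutputSet ≠ ⊤ := by
    intro h
    simp [h] at hcov
  set C := Metric.minimalCover δ W.sqrtOutputSet
  have hCfin : C.Finite := Metric.finite_minimalCover
  have hCcard : (hCfin.toFinset.card : ℕ∞) = Metric.coveringNumber δ W.sqrtOutputSet := by
    rw [← Metric.encard_minimalCover htop, hCfin.encard_eq_coe_toFinset_card]
  have hCpos : 0 < hCfin.toFinset.card := by
    rw [Nat.pos_iff_ne_zero]
    intro h
    rw [h] at hCcard
    exact W.coveringNumber_sqrtOutputSet_ne_zero δ hCcard.symm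
  rw [← hCcard, ENat.toENNReal_coe, ENNReal.log_natCast hCpos, EReal.coe_lt_coe_iff] at hcov
  refine superexpRate_le hn (pow_pos hCpos n) (fun N u E hcode => ?_) (M := _) ?_
  · refine hcode.le_card_pow_of_cover δ.coe_nonneg ?_ fun x => ?_
    · refine lt_of_eq_of_lt ?_ hsmall
      rw [hδr, mul_assoc, Real.sqrt_eq_rpow, ← Real.rpow_add hn0]
      ring_nf
    · obtain ⟨c, hc, hxc⟩ := Metric.isCover_minimalCover htop (Set.mem_range_self x)
      refine ⟨c, hCfin.mem_toFinset.2 hc, ?_⟩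
      have hxc : edist (W.sqrtVec x) c ≤ δ := hxc
      rw [edist_nndist, ENNReal.coe_le_coe] at hxc
      exact_mod_cast hxc
  · push_cast
    rw [Real.log_pow]
    calc n * Real.log hCfin.toFinset.card ≤ n * (c * ((1 / 2 + s) * Real.log n)) := by gcongr
      _ = (c * (1 / 2 + s)) * (n * Real.log n) := by ring
      _ ≤ b * (n * Real.log n) := by gcongr

/-- If `m` letters give `N` messages as in the Gilbert–Varshamov bound, with `log M ≥ c L` and
`n ≤ 2 exp (p L)`, then the rate is at least `a` as soon as `(1 - t) c > a p` and `L` is large. -/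
lemma mul_log_le_log_of_pow_le {n N m k : ℕ} {a c p t L : ℝ} (hn : 2 ≤ n) (hm : 0 < m)
    (ha : 0 ≤ a) (ht : t ≤ 1) (hcL : c * L ≤ Real.log m) (ht0 : 0 ≤ t)
    (hlogn : Real.log n ≤ p * L + Real.log 2)
    (hL : Real.log 2 + k + a * Real.log 2 ≤ L * ((1 - t) * c - a * p))
    (h : (m : ℝ) ^ n ≤ N * (2 ^ n * m ^ ⌊t * n⌋₊) * (k * n + 1)) :
    0 < N ∧ a * (n * Real.log n) ≤ Real.log N := by
  have hm' : (1 : ℝ) ≤ m := by exact_mod_cast hm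
  have hm0 : (0 : ℝ) < m := by linarith
  have hn0 : (0 : ℝ) < n := by positivity
  have hN : 0 < N := by
    rw [Nat.pos_iff_ne_zero]
    rintro rfl
    have : (0 : ℝ) < (m : ℝ) ^ n := by positivity
    simp at h
    linarith
  refine ⟨hN, ?_⟩
  have hN0 : (0 : ℝ) < N := by exact_mod_cast hN
  have h1 := Real.log_le_log (by positivity) h
  rw [Real.log_mul (by positivity) (by positivity), Real.log_mul hN0.ne' (by positivity),
    Real.log_mul (by positivity) (by positivity), Real.log_pow, Real.log_pow, Real.log_pow] at h1
  have h2 : Real.log (k * n + 1) ≤ k * n := by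
    linarith [Real.log_le_sub_one_of_pos (by positivity : (0 : ℝ) < k * n + 1)]
  have h3 : (⌊t * n⌋₊ : ℝ) * Real.log m ≤ t * n * Real.log m :=
    mul_le_mul_of_nonneg_right (Nat.floor_le (by positivity)) (Real.log_nonneg hm')
  have h4 : (1 - t) * (c * L) ≤ (1 - t) * Real.log m :=
    mul_le_mul_of_nonneg_left hcL (by linarith)
  have h5 : a * Real.log n ≤ a * (p * L + Real.log 2) := mul_le_mul_of_nonneg_left hlogn ha
  have h6 : a * Real.log n ≤ (1 - t) * Real.log m - Real.log 2 - k := by linarith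
  have h7 := mul_le_mul_of_nonneg_left h6 hn0.le
  linarith

/-- The direct part: the radii `δ → 0` at which the covering number is large are turned into block
lengths `n = ⌈δ ^ (-(4 + t))⌉`. -/
lemma le_limsup_superexpRate [Nonempty X] (W : Channel X Y) {l₁ l₂ : ℝ} (hl₁ : 0 < l₁)
    (hl₂ : 0 < l₂) :
    ((1 / 4 : ℝ) : EReal) * upperMinkowskiDim W.sqrtOutputSet ≤
      limsup (W.superexpRate l₁ l₂) atTop := by
  rw [← EReal.ge_of_forall_gt_iff_ge]
  intro a ha
  rcases lt_or_ge a 0 with ha0 | ha0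
  · refine le_limsup_of_frequently_le (Eventually.frequently ?_) (by isBoundedDefault)
    filter_upwards [eventually_ge_atTop 2] with n hn
    exact (EReal.coe_le_coe ha0.le).trans (W.superexpRate_nonneg hl₁ hn)
  have hd : ((4 * a : ℝ) : EReal) < upperMinkowskiDim W.sqrtOutputSet := by
    by_contra! hcon
    refine ha.not_ge ?_
    calc ((1 / 4 : ℝ) : EReal) * upperMinkowskiDim W.sqrtOutputSet
        ≤ ((1 / 4 : ℝ) : EReal) * ((4 * a : ℝ) : EReal) :=
          mul_le_mul_of_nonneg_left hcon (by exact_mod_cast (by norm_num : (0 : ℝ) ≤ 1 / 4))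
      _ = a := by rw [← EReal.coe_mul]; congr 1; ring
  obtain ⟨c, hac, hcd⟩ := EReal.lt_iff_exists_real_btwn.1 hd
  have hac : 4 * a < c := by exact_mod_cast hac
  -- The block length is about `δ ^ (-(4 + t))`, and code words differ in a fraction `t` of letters.
  obtain ⟨t, ht0, ht1, htc⟩ : ∃ t : ℝ, 0 < t ∧ t ≤ 1 ∧ a * (4 + t) < (1 - t) * c := by
    refine ⟨(c - 4 * a) / (2 * (c + a)), div_pos (by linarith) (by linarith), ?_, ?_⟩
    · rw [div_le_one (by linarith)]
      linarith
    · have h : (c - 4 * a) / (2 * (c + a)) * (c + a) = (c - 4 * a) / 2 := by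
        field_simp [(by linarith : c + a ≠ 0)]
      linarith
  obtain ⟨K, hK, hK₁, hK₂⟩ : ∃ K : ℝ, 0 < K ∧ 4 * Fintype.card Y / K ^ 2 ≤ l₁ ∧
      4 * Fintype.card Y / K ^ 2 ≤ l₂ / 2 := by
    have h : Tendsto (fun K : ℝ => 4 * (Fintype.card Y : ℝ) / K ^ 2) atTop (𝓝 0) :=
      tendsto_const_nhds.div_atTop (tendsto_pow_atTop two_ne_zero)
    exact ((eventually_gt_atTop 0).and ((h.eventually_le_const hl₁).and
      (h.eventually_le_const (half_pos hl₂)))).exists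
  have hn_lim : Tendsto (fun δ : ℝ≥0 => ⌈Real.exp ((4 + t) * -Real.log δ)⌉₊) (𝓝[>] 0) atTop :=
    tendsto_nat_ceil_atTop.comp (Real.tendsto_exp_atTop.comp
      (tendsto_neg_log_nnreal_nhdsGT_zero.const_mul_atTop (by linarith)))
  refine le_limsup_of_frequently_le (hn_lim.frequently ?_) (by isBoundedDefault)
  have hL₁ := tendsto_neg_log_nnreal_nhdsGT_zero.eventually_gt_atTop 0
  have hL₂ := (tendsto_neg_log_nnreal_nhdsGT_zero.atTop_mul_const
    (sub_pos.2 htc)).eventually_ge_atTop (Real.log 2 + Fintype.card Y + a * Real.log 2)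
  have hL₃ := ((Real.tendsto_exp_atTop.comp (tendsto_neg_log_nnreal_nhdsGT_zero.const_mul_atTop
    (half_pos ht0))).const_mul_atTop ht0).eventually_ge_atTop (2 * K + 1 + 2 * |Real.log (l₂ / 2)|)
  refine ((frequently_lt_of_lt_limsup (by isBoundedDefault) hcd).and_eventually
    (((hn_lim.eventually_ge_atTop 2).and hL₁).and
      ((hL₂.and hL₃).and self_mem_nhdsWithin))).mono ?_
  rintro δ ⟨hcov, ⟨hn, hL₁⟩, ⟨hL₂, hL₃⟩, hδ⟩
  simp only [Function.comp_apply] at hL₃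
  have hδ0 : (0 : ℝ) < δ := NNReal.coe_pos.2 hδ
  set L : ℝ := -Real.log δ with hL
  set n : ℕ := ⌈Real.exp ((4 + t) * L)⌉₊ with hndef
  have hn0 : 0 < n := by omega
  have hδL : (δ : ℝ) = Real.exp (-L) := by rw [hL, neg_neg, Real.exp_log hδ0]
  have hnL : Real.exp ((4 + t) * L) ≤ n := Nat.le_ceil _
  have hc0 : 0 < c := by linarith
  obtain ⟨m, hm0, hm, hcm⟩ : ∃ m : ℕ, 0 < m ∧
      (m : ℕ∞) ≤ Metric.coveringNumber δ W.sqrtOutputSet ∧ c * L ≤ Real.log m := by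
    rw [EReal.lt_div_iff (by exact_mod_cast hL₁) (EReal.coe_ne_top _), ← EReal.coe_mul] at hcov
    by_cases htop : Metric.coveringNumber δ W.sqrtOutputSet = ⊤
    · refine ⟨⌈Real.exp (c * L)⌉₊, Nat.ceil_pos.2 (Real.exp_pos _), by simp [htop], ?_⟩
      rw [Real.le_log_iff_exp_le (by exact_mod_cast Nat.ceil_pos.2 (Real.exp_pos _))]
      exact Nat.le_ceil _
    · obtain ⟨m, hm⟩ := ENat.ne_top_iff_exists.1 htop
      have hm0 : 0 < m := by
        rw [Nat.pos_iff_ne_zero]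
        rintro rfl
        exact W.coveringNumber_sqrtOutputSet_ne_zero δ hm.symm
      refine ⟨m, hm0, hm.le, ?_⟩
      rw [← hm, ENat.toENNReal_coe, ENNReal.log_natCast hm0, EReal.coe_lt_coe_iff] at hcov
      exact hcov.le
  obtain ⟨S, hScard, hsep⟩ := W.exists_separated_card_eq hm
  -- The Hellinger distance `t n δ²` of the code words beats `√n`.
  have hbig : Real.exp (((2 * K + 1) * √n - t * n * (δ : ℝ) ^ 2) / 2) ≤ l₂ / 2 := by
    have hsq : 1 ≤ √(n : ℝ) := Real.one_le_sqrt.2 (Nat.one_le_cast.2 hn0)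
    have h1 : Real.exp ((2 + t / 2) * L) ≤ √n := by
      refine Real.le_sqrt_of_sq_le (le_of_eq_of_le ?_ hnL)
      rw [← Real.exp_nat_mul]
      congr 1
      push_cast
      ring
    have h2 : Real.exp (t / 2 * L) ≤ √n * (δ : ℝ) ^ 2 := by
      calc Real.exp (t / 2 * L) = Real.exp ((2 + t / 2) * L) * (δ : ℝ) ^ 2 := by
            rw [hδL, ← Real.exp_nat_mul, ← Real.exp_add]
            congr 1
            push_cast
            ring
        _ ≤ _ := by gcongr
    have h3 : 2 * K + 1 + 2 * |Real.log (l₂ / 2)| ≤ t * (√n * (δ : ℝ) ^ 2) :=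
      hL₃.trans (by gcongr)
    have h4 : t * n * (δ : ℝ) ^ 2 = √n * (t * (√n * (δ : ℝ) ^ 2)) := by
      linear_combination -(t * (δ : ℝ) ^ 2) * Real.mul_self_sqrt (Nat.cast_nonneg (α := ℝ) n)
    rw [← Real.le_log_iff_exp_le (half_pos hl₂), h4]
    have h5 := mul_le_mul_of_nonneg_left h3 (by positivity : 0 ≤ √(n : ℝ))
    have h6 := mul_le_mul_of_nonneg_right hsq (abs_nonneg (Real.log (l₂ / 2)))
    linarith [neg_abs_le (Real.log (l₂ / 2))]
  obtain ⟨N, u, E, hcode, hN⟩ := W.exists_isDICode hn0 hK hδ0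
    (Finset.card_pos.1 (hScard ▸ hm0)) hsep hK₁ hK₂ hbig
  have hlogn : Real.log n ≤ (4 + t) * L + Real.log 2 := by
    have h1 : (1 : ℝ) ≤ Real.exp ((4 + t) * L) := Real.one_le_exp (by positivity)
    have h2 : (n : ℝ) ≤ Real.exp ((4 + t) * L) * 2 := by
      linarith [Nat.ceil_lt_add_one (Real.exp_pos ((4 + t) * L)).le]
    calc Real.log n ≤ Real.log (Real.exp ((4 + t) * L) * 2) :=
          Real.log_le_log (by exact_mod_cast hn0) h2
      _ = _ := by rw [Real.log_mul (Real.exp_pos _).ne' two_ne_zero, Real.log_exp]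
  rw [hScard] at hN
  obtain ⟨hNpos, hNlog⟩ := mul_log_le_log_of_pow_le hn hm0 ha0 ht1 hcm ht0.le hlogn hL₂ hN
  exact le_superexpRate hn hNpos hcode hNlog

end Channel

theorem mainTheorem2 {X Y : Type*} [Nonempty X] [Fintype Y] (W : Channel X Y) :
    ((1 / 4 : ℝ) : EReal) * upperMinkowskiDim W.sqrtOutputSet ≤ W.optimisticDICapacity ∧
    ∀ l₁ l₂ : ℝ, 0 < l₁ → 0 < l₂ → l₁ + l₂ < 1 →
      W.optimisticDICapacity ≤ limsup (W.superexpRate l₁ l₂) atTop ∧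
      limsup (W.superexpRate l₁ l₂) atTop ≤
        ((1 / 2 : ℝ) : EReal) * upperMinkowskiDim W.sqrtOutputSet := by
  refine ⟨le_iInf₂ fun l₁ hl₁ => le_iInf₂ fun l₂ hl₂ => W.le_limsup_superexpRate hl₁ hl₂,
    fun l₁ l₂ hl₁ hl₂ hl => ⟨?_, W.limsup_superexpRate_le hl⟩⟩
  exact (iInf₂_le l₁ hl₁).trans (iInf₂_le l₂ hl₂)
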